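/- Let $(M,g)$ be a smooth Riemannian manifold of dimension $n\ge 3$. For $x\in M$ let $k$ denote the sectional curvature of two-dimensional subspaces of $T_xM$, and let $$\tau(x)=\sum_{1\le i<j\le n}R(e_i,e_j,e_i,e_j)$$ be the scalar curvature at $x$, where $\{e_1,\dots,e_n\}$ is an orthonormal frame of $T_xM$ and the curvature tensor $R$ is normalized so that $R(X,Y,X,Y)$ is the sectional curvature of the plane with orthonormal basis $X,Y$ (so $\tau$ is the sum of the sectional curvatures of the coordinate planes of the frame). Let $\widetilde M(c)$ be a real space form, that is, a smooth Riemannian manifold of arbitrary dimension $m$ all of whose sectional curvatures are equal to the constant $c\in\mathbb R$. If $(M,g)$ admits a minimal isometric immersion into $\widetilde M(c)$ (an isometric immersion whose mean curvature vector $H=\frac1n\sum_{i=1}^n h(e_i,e_i)$ vanishes identically, where $h$ is the second fundamental form), then for every $x\in M$ and every two-dimensional subspace $\pi\subset T_xM$ $$\tau(x)-\frac{(n-2)(n+1)c}{2}\;\le\; k(\pi)\;\le\; -\tau(x)+\frac{(n^2-n+2)c}{2}.$$ -/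

import Mathlib

open scoped Manifold ContDiff Bundle

noncomputable section

namespace SpaceFormImmersion

/-! ### Local Riemannian geometry of a metric `G` on a vector space of coordinates -/

section Coordinates

variable {V : Type*} [NormedAddCommGroup V] [NormedSpace ℝ V]

/-- The Christoffel symbols `Γ_y(u, v)` of the Levi-Civita connection of a metric `G` given in
coordinates, that is, the vector with
`G_y(Γ_y(u, v), w) = (∂_u G(v, w) + ∂_v G(u, w) - ∂_w G(u, v)) / 2` for all `w`.
(`G y`, read as a map from vectors to covectors, is invertible for a metric in finite dimension.) -/
def christoffel (G : V → V →L[ℝ] V →L[ℝ] ℝ) (y u v : V) : V :=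
  (G y).inverse ((1 / 2 : ℝ) •
    (fderiv ℝ G y u v + fderiv ℝ G y v u - ((fderiv ℝ G y).flip u).flip v))

/-- The curvature operator `R(u, v) w = ∇_u ∇_v w - ∇_v ∇_u w` at `y`, where `∇` is the Levi-Civita
connection of `G` and `u, v, w` are extended to constant (hence commuting) vector fields, so that
`∇_v w = Γ(v, w)` and `∇_u (∇_v w) = ∂_u (Γ(v, w)) + Γ(u, Γ(v, w))`. -/
def curvatureOperator (G : V → V →L[ℝ] V →L[ℝ] ℝ) (y u v w : V) : V :=
  (fderiv ℝ (fun z ↦ christoffel G z v w) y u + christoffel G y u (christoffel G y v w)) -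
    (fderiv ℝ (fun z ↦ christoffel G z u w) y v + christoffel G y v (christoffel G y u w))

end Coordinates

/-! ### Riemannian manifolds -/

/-- Euclidean coordinate space of dimension `n`. -/
abbrev Coord (n : ℕ) : Type := EuclideanSpace ℝ (Fin n)

/-- A smooth Riemannian metric on (the tangent bundle of) an `n`-dimensional manifold `M`. -/
abbrev SmoothMetric (n : ℕ) (M : Type*) [TopologicalSpace M] [ChartedSpace (Coord n) M]
    [IsManifold (𝓡 n) ∞ M] : Type _ :=
  Bundle.ContMDiffRiemannianMetric (𝓡 n) ∞ (Coord n) (fun x : M ↦ TangentSpace (𝓡 n) x)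

section Manifold

variable {n : ℕ} {M : Type*} [TopologicalSpace M] [ChartedSpace (Coord n) M]
  [IsManifold (𝓡 n) ∞ M]

/-- The metric `g` written in the coordinates `φ` of the preferred chart at `x`:
`G_y(u, v) = g(D(φ⁻¹)_y u, D(φ⁻¹)_y v)`. -/
def metricInChart (g : SmoothMetric n M) (x : M) (y : Coord n) : Coord n →L[ℝ] Coord n →L[ℝ] ℝ :=
  let B : Coord n →L[ℝ] Coord n →L[ℝ] ℝ := g.inner ((extChartAt (𝓡 n) x).symm y)
  let A : Coord n →L[ℝ] Coord n :=
    mfderiv 𝓘(ℝ, Coord n) (𝓡 n) (extChartAt (𝓡 n) x).symm y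
  B.bilinearComp A A

/-- The Riemann curvature tensor at `x`, `R(X, Y, Z, W) = g(R(Z, W) Y, X)`, so that
`R(X, Y, X, Y)` is the sectional curvature of the plane with orthonormal basis `X, Y`.
It is computed in the preferred chart at `x`; Mathlib's `TangentSpace (𝓡 n) x` is the coordinate
space of exactly this chart, with the derivative of the chart at `x` being the identity. -/
def riemannTensor (g : SmoothMetric n M) (x : M) (X Y Z W : TangentSpace (𝓡 n) x) : ℝ :=
  g.inner x (curvatureOperator (V := Coord n) (metricInChart g x) (extChartAt (𝓡 n) x x) Z W Y) X

/-- The sectional curvature at `x` of the plane spanned by linearly independent `X, Y`. -/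
def sectionalCurvature (g : SmoothMetric n M) (x : M) (X Y : TangentSpace (𝓡 n) x) : ℝ :=
  riemannTensor g x X Y X Y / (g.inner x X X * g.inner x Y Y - g.inner x X Y ^ 2)

/-- `e` is an orthonormal frame of `T_x M` (it has `n = dim M` members). -/
def IsOrthonormalFrame (g : SmoothMetric n M) (x : M) (e : Fin n → TangentSpace (𝓡 n) x) : Prop :=
  ∀ i j, g.inner x (e i) (e j) = if i = j then 1 else 0

/-- The scalar curvature `τ = ∑_{i < j} R(e_i, e_j, e_i, e_j)` at `x`, computed in an orthonormal
frame `e` of `T_x M`. -/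
def scalarCurvature (g : SmoothMetric n M) (x : M) (e : Fin n → TangentSpace (𝓡 n) x) : ℝ :=
  ∑ i : Fin n, ∑ j ∈ Finset.Ioi i, riemannTensor g x (e i) (e j) (e i) (e j)

/-- `(M, g)` is a real space form of curvature `c`: all its sectional curvatures are equal to `c`
(neither completeness nor simple connectedness is asked for). -/
def IsRealSpaceForm (g : SmoothMetric n M) (c : ℝ) : Prop :=
  ∀ (x : M) (X Y : TangentSpace (𝓡 n) x), LinearIndependent ℝ ![X, Y] →
    sectionalCurvature g x X Y = c

end Manifold

/-! ### Isometric immersions -/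

section Immersion

variable {n m : ℕ} {M N : Type*}
  [TopologicalSpace M] [ChartedSpace (Coord n) M] [IsManifold (𝓡 n) ∞ M]
  [TopologicalSpace N] [ChartedSpace (Coord m) N] [IsManifold (𝓡 m) ∞ N]

/-- A smooth map `f : (M, g) → (N, g')` with `f^* g' = g`. Its differentials are then injective
because `g` is positive definite, so that it is an immersion. -/
structure IsIsometricImmersion (g : SmoothMetric n M) (g' : SmoothMetric m N) (f : M → N) : Prop where
  contMDiff : ContMDiff (𝓡 n) (𝓡 m) ∞ f
  isometric : ∀ (x : M) (X Y : TangentSpace (𝓡 n) x),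
    g'.inner (f x) (mfderiv (𝓡 n) (𝓡 m) f x X) (mfderiv (𝓡 n) (𝓡 m) f x Y) = g.inner x X Y

/-- The second fundamental form `h(X, Y) = ∇'_X (f_* Y) - f_* (∇_X Y)` at `x` of an isometric
immersion `f`, where `∇, ∇'` are the Levi-Civita connections of `g, g'`. In the preferred charts at
`x` and `f x`, with `F` the coordinate expression of `f` and `X, Y` extended to constant fields,
this is `D²F(X, Y) + Γ'(DF X, DF Y) - DF(Γ(X, Y))`. -/
def secondFundamentalForm (g : SmoothMetric n M) (g' : SmoothMetric m N) (f : M → N) (x : M)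
    (X Y : TangentSpace (𝓡 n) x) : TangentSpace (𝓡 m) (f x) :=
  let F : Coord n → Coord m := writtenInExtChartAt (𝓡 n) (𝓡 m) x f
  let p : Coord n := extChartAt (𝓡 n) x x
  let q : Coord m := extChartAt (𝓡 m) (f x) (f x)
  (fderiv ℝ (fun y ↦ fderiv ℝ F y Y) p X
    + christoffel (metricInChart g' (f x)) q (fderiv ℝ F p X) (fderiv ℝ F p Y)
    - fderiv ℝ F p (christoffel (metricInChart g x) p X Y) : Coord m)

/-- The mean curvature vector `H = (1/n) ∑ h(e_i, e_i)` at `x`, computed in an orthonormal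
frame `e` of `T_x M`. -/
def meanCurvatureVector (g : SmoothMetric n M) (g' : SmoothMetric m N) (f : M → N) (x : M)
    (e : Fin n → TangentSpace (𝓡 n) x) : TangentSpace (𝓡 m) (f x) :=
  (1 / (n : ℝ)) • ∑ i, secondFundamentalForm g g' f x (e i) (e i)

/-- An isometric immersion with vanishing mean curvature vector. -/
structure IsMinimalIsometricImmersion (g : SmoothMetric n M) (g' : SmoothMetric m N) (f : M → N) : Prop
    extends IsIsometricImmersion g g' f where
  meanCurvatureVector_eq_zero : ∀ (x : M) (e : Fin n → TangentSpace (𝓡 n) x),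
    IsOrthonormalFrame g x e → meanCurvatureVector g g' f x e = 0

end Immersion

end SpaceFormImmersion

end

/-! The Gauss equation turns the theorem into linear algebra of the second fundamental form `h` at
one point. For an orthonormal basis `X, Y` of the plane, `k = c + ⟨h(X,X), h(Y,Y)⟩ - |h(X,Y)|²`. Put
`S = ∑ |h(e_i,e_j)|²`. Summing over the pairs `i < j` and using `∑ h(e_i,e_i) = 0` gives `τ =
n(n-1)c/2 - S/2` (`scalarCurvature_eq`). Bessel's inequality in both slots gives `|h(X,X)|² +
|h(Y,Y)|² + 2|h(X,Y)|² ≤ S` (`restrict_norm_sq_le`), hence `|k - c| ≤ S/2` (`abs_gauss_le`,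
`sectionalCurvature_eq`). Eliminating `S` yields both bounds.

Most of the work is the Gauss equation itself (`gauss_equation`), proved in coordinates for an
isometric map between two metrics on vector spaces: `h` is normal, its derivative satisfies the
Weingarten equation, and antisymmetrizing removes the third derivatives of the map. It is carried to
the manifolds by the preferred charts, whose inverse has identity differential at the base point. -/

namespace SpaceFormImmersion

open scoped Topology

set_option maxSynthPendingDepth 3

/-! ### The Levi-Civita connection of a metric in coordinates. -/

section CoordinateGeometry

variable {V : Type*} [NormedAddCommGroup V] [NormedSpace ℝ V]

/-- `G` is a smooth metric near the point `y` of a coordinate space. -/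
structure IsMetricAt (G : V → V →L[ℝ] V →L[ℝ] ℝ) (y : V) : Prop where
  smooth : ∀ᶠ z in 𝓝 y, ContDiffAt ℝ ∞ G z
  symm : ∀ᶠ z in 𝓝 y, ∀ u v, G z u v = G z v u
  posDef : ∀ᶠ z in 𝓝 y, ∀ v, v ≠ 0 → 0 < G z v v

/-- The Christoffel symbols of the first kind, as a bilinear map with values in covectors. -/
noncomputable def christoffelFirst (G : V → V →L[ℝ] V →L[ℝ] ℝ) (y : V) :
    V →L[ℝ] V →L[ℝ] V →L[ℝ] ℝ :=
  (1 / 2 : ℝ) • (fderiv ℝ G y + (fderiv ℝ G y).flip -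
    (ContinuousLinearMap.flipₗᵢ ℝ V V ℝ).toContinuousLinearEquiv.toContinuousLinearMap ∘L
      (fderiv ℝ G y).flip)

/-- The Christoffel symbols as a continuous bilinear map. -/
noncomputable def christoffelBilin (G : V → V →L[ℝ] V →L[ℝ] ℝ) (y : V) : V →L[ℝ] V →L[ℝ] V :=
  (ContinuousLinearMap.compL ℝ V (V →L[ℝ] ℝ) V (G y).inverse) ∘L christoffelFirst G y

theorem christoffelBilin_apply (G : V → V →L[ℝ] V →L[ℝ] ℝ) (y u v : V) :
    christoffelBilin G y u v = christoffel G y u v := rfl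

theorem christoffelFirst_apply (G : V → V →L[ℝ] V →L[ℝ] ℝ) (y u v w : V) :
    christoffelFirst G y u v w =
      1 / 2 * (fderiv ℝ G y u v w + fderiv ℝ G y v u w - fderiv ℝ G y w u v) := rfl

/-- Definiteness gives injectivity, and `V` and its dual have equal dimension. Without this, the
`inverse` in `christoffel` would take its default value. -/
theorem isInvertible_of_pos [FiniteDimensional ℝ V] {B : V →L[ℝ] V →L[ℝ] ℝ}
    (hB : ∀ v, v ≠ 0 → 0 < B v v) : B.IsInvertible := by
  have hinj : Function.Injective (B : V →ₗ[ℝ] V →L[ℝ] ℝ) := by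
    rw [← LinearMap.ker_eq_bot, LinearMap.ker_eq_bot']
    intro v hv
    by_contra hne
    have h := hB v hne
    have h0 : B v = 0 := hv
    rw [h0] at h
    simp at h
  have hdim : Module.finrank ℝ V = Module.finrank ℝ (V →L[ℝ] ℝ) := by
    rw [← (LinearMap.toContinuousLinearMap : (V →ₗ[ℝ] ℝ) ≃ₗ[ℝ] (V →L[ℝ] ℝ)).finrank_eq]
    exact (Subspace.dual_finrank_eq (K := ℝ) (V := V)).symm
  refine ⟨(LinearEquiv.ofInjectiveOfFinrankEq (B : V →ₗ[ℝ] V →L[ℝ] ℝ) hinj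
    hdim).toContinuousLinearEquiv, ?_⟩
  ext v
  rfl

namespace IsMetricAt

variable {G : V → V →L[ℝ] V →L[ℝ] ℝ} {y : V}

theorem eventually (hG : IsMetricAt G y) : ∀ᶠ z in 𝓝 y, IsMetricAt G z := by
  filter_upwards [eventually_eventually_nhds.2 hG.smooth, eventually_eventually_nhds.2 hG.symm,
    eventually_eventually_nhds.2 hG.posDef] with z h1 h2 h3 using ⟨h1, h2, h3⟩

theorem contDiffAt (hG : IsMetricAt G y) : ContDiffAt ℝ ∞ G y :=
  hG.smooth.self_of_nhds

theorem pos (hG : IsMetricAt G y) (v : V) (hv : v ≠ 0) : 0 < G y v v :=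
  hG.posDef.self_of_nhds v hv

theorem symm_self (hG : IsMetricAt G y) (u v : V) : G y u v = G y v u :=
  hG.symm.self_of_nhds u v

theorem differentiableAt (hG : IsMetricAt G y) : DifferentiableAt ℝ G y :=
  hG.contDiffAt.differentiableAt (by simp)

theorem fderiv_symm (hG : IsMetricAt G y) (w u v : V) :
    fderiv ℝ G y w u v = fderiv ℝ G y w v u := by
  have h : G =ᶠ[𝓝 y] fun z ↦ (ContinuousLinearMap.flipₗᵢ ℝ V V ℝ) (G z) := by
    filter_upwards [hG.symm] with z hz
    ext a b
    exact hz a b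
  have h2 : HasFDerivAt (fun z ↦ (ContinuousLinearMap.flipₗᵢ ℝ V V ℝ) (G z))
      ((ContinuousLinearMap.flipₗᵢ ℝ V V ℝ).toContinuousLinearEquiv.toContinuousLinearMap ∘L
        fderiv ℝ G y) y :=
    ((ContinuousLinearMap.flipₗᵢ ℝ V V ℝ).toContinuousLinearEquiv.toContinuousLinearMap.hasFDerivAt
      ).comp y hG.differentiableAt.hasFDerivAt
  have h3 := (h2.congr_of_eventuallyEq h).fderiv
  conv_lhs => rw [h3]
  rfl

theorem eq_of_apply_eq (hG : IsMetricAt G y) {a b : V} (h : ∀ w, G y a w = G y b w) : a = b := by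
  by_contra hne
  have h1 := hG.pos (a - b) (sub_ne_zero.2 hne)
  have h2 := h (a - b)
  simp only [map_sub, sub_apply] at h1 h2
  linarith

variable [FiniteDimensional ℝ V]

/-- The Koszul formula: pairing with `G` undoes the inverse, so later computations need only first
derivatives of `G`. -/
theorem apply_christoffel (hG : IsMetricAt G y) (u v w : V) :
    G y (christoffel G y u v) w =
      1 / 2 * (fderiv ℝ G y u v w + fderiv ℝ G y v u w - fderiv ℝ G y w u v) := by
  rw [← christoffelFirst_apply, ← christoffelBilin_apply]
  have h : G y ((G y).inverse (christoffelFirst G y u v)) = christoffelFirst G y u v :=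
    (isInvertible_of_pos hG.pos).self_apply_inverse _
  exact congrArg (fun l : V →L[ℝ] ℝ ↦ l w) h

theorem christoffel_symm (hG : IsMetricAt G y) (u v : V) :
    christoffel G y u v = christoffel G y v u := by
  refine hG.eq_of_apply_eq fun w ↦ ?_
  rw [hG.apply_christoffel, hG.apply_christoffel, hG.fderiv_symm w u v]
  ring

/-- The Levi-Civita connection is compatible with the metric. -/
theorem fderiv_apply (hG : IsMetricAt G y) (u v w : V) :
    fderiv ℝ G y u v w = G y (christoffel G y u v) w + G y v (christoffel G y u w) := by
  rw [hG.symm_self v, hG.apply_christoffel, hG.apply_christoffel]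
  linarith [hG.fderiv_symm u w v, hG.fderiv_symm w v u, hG.fderiv_symm v u w]

theorem contDiffAt_christoffelBilin (hG : IsMetricAt G y) :
    ContDiffAt ℝ ∞ (christoffelBilin G) y := by
  have := FiniteDimensional.complete ℝ V
  have h1 : ContDiffAt ℝ ∞ (fderiv ℝ G) y := hG.contDiffAt.fderiv_right (by simp)
  have h2 : ContDiffAt ℝ ∞ (fun z ↦ (G z).inverse) y :=
    ContDiffAt.comp y (isInvertible_of_pos hG.pos).contDiffAt_map_inverse hG.contDiffAt
  have h3 : ContDiffAt ℝ ∞ (fun z ↦ (fderiv ℝ G z).flip) y :=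
    ContDiffAt.comp y (ContinuousLinearMap.flipₗᵢ ℝ V V
      (V →L[ℝ] ℝ)).toContinuousLinearEquiv.contDiff.contDiffAt h1
  have h4 : ContDiffAt ℝ ∞ (christoffelFirst G) y :=
    ((h1.add h3).sub (contDiffAt_const.clm_comp h3)).const_smul (1 / 2 : ℝ)
  exact ((ContinuousLinearMap.compL ℝ V (V →L[ℝ] ℝ) V).contDiff.contDiffAt.comp y h2).clm_comp h4

theorem fderiv_christoffel (hG : IsMetricAt G y) (u v w : V) :
    fderiv ℝ (fun z ↦ christoffel G z v w) y u = fderiv ℝ (christoffelBilin G) y u v w := by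
  have h := (hG.contDiffAt_christoffelBilin.differentiableAt (by simp)).hasFDerivAt
  have h2 := (h.clm_apply (hasFDerivAt_const v y)).clm_apply (hasFDerivAt_const w y)
  have h3 : HasFDerivAt (fun z ↦ christoffel G z v w) _ y := h2
  rw [h3.fderiv]
  simp

end IsMetricAt

end CoordinateGeometry

/-! ### The Weingarten and Gauss equations in coordinates. -/

section GaussEquation

variable {V W : Type*} [NormedAddCommGroup V] [NormedSpace ℝ V] [NormedAddCommGroup W]
  [NormedSpace ℝ W]

/-- `F` is an isometric immersion near `p` of the metric `G` into the metric `G'`. -/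
structure IsIsometricAt (G : V → V →L[ℝ] V →L[ℝ] ℝ) (G' : W → W →L[ℝ] W →L[ℝ] ℝ) (F : V → W)
    (p : V) : Prop where
  source : IsMetricAt G p
  target : IsMetricAt G' (F p)
  smooth : ∀ᶠ y in 𝓝 p, ContDiffAt ℝ ∞ F y
  isometric : ∀ᶠ y in 𝓝 p, ∀ u v, G y u v = G' (F y) (fderiv ℝ F y u) (fderiv ℝ F y v)

/-- The covariant derivative along `F` of the differential of `F` on constant fields. -/
noncomputable def pushforwardDeriv (G' : W → W →L[ℝ] W →L[ℝ] ℝ) (F : V → W) (y u v : V) : W :=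
  fderiv ℝ (fderiv ℝ F) y u v +
    christoffelBilin G' (F y) (fderiv ℝ F y u) (fderiv ℝ F y v)

/-- The second fundamental form in coordinates. -/
noncomputable def coordSecondForm (G : V → V →L[ℝ] V →L[ℝ] ℝ) (G' : W → W →L[ℝ] W →L[ℝ] ℝ)
    (F : V → W) (y u v : V) : W :=
  pushforwardDeriv G' F y u v - fderiv ℝ F y (christoffelBilin G y u v)

namespace IsIsometricAt

variable {G : V → V →L[ℝ] V →L[ℝ] ℝ} {G' : W → W →L[ℝ] W →L[ℝ] ℝ} {F : V → W} {p : V}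

theorem contDiffAt (h : IsIsometricAt G G' F p) : ContDiffAt ℝ ∞ F p :=
  h.smooth.self_of_nhds

theorem eventually (h : IsIsometricAt G G' F p) : ∀ᶠ y in 𝓝 p, IsIsometricAt G G' F y := by
  filter_upwards [h.source.eventually, h.contDiffAt.continuousAt.eventually h.target.eventually,
    eventually_eventually_nhds.2 h.smooth, eventually_eventually_nhds.2 h.isometric]
    with y h1 h2 h3 h4 using ⟨h1, h2, h3, h4⟩

theorem hasFDerivAt (h : IsIsometricAt G G' F p) : HasFDerivAt F (fderiv ℝ F p) p :=
  (h.contDiffAt.differentiableAt (by simp)).hasFDerivAt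

theorem contDiffAt_fderiv (h : IsIsometricAt G G' F p) : ContDiffAt ℝ ∞ (fderiv ℝ F) p :=
  h.contDiffAt.fderiv_right (by simp)

theorem hasFDerivAt_fderiv (h : IsIsometricAt G G' F p) :
    HasFDerivAt (fderiv ℝ F) (fderiv ℝ (fderiv ℝ F) p) p :=
  (h.contDiffAt_fderiv.differentiableAt (by simp)).hasFDerivAt

theorem hasFDerivAt_fderiv_fderiv (h : IsIsometricAt G G' F p) :
    HasFDerivAt (fderiv ℝ (fderiv ℝ F)) (fderiv ℝ (fderiv ℝ (fderiv ℝ F)) p) p :=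
  ((h.contDiffAt_fderiv.fderiv_right (m := ∞) (by simp)).differentiableAt (by simp)).hasFDerivAt

theorem fderiv_fderiv_symm (h : IsIsometricAt G G' F p) (u v : V) :
    fderiv ℝ (fderiv ℝ F) p u v = fderiv ℝ (fderiv ℝ F) p v u :=
  h.contDiffAt.isSymmSndFDerivAt (by
    rw [minSmoothness_of_isRCLikeNormedField]
    exact WithTop.coe_le_coe.2 (le_top : (2 : ℕ∞) ≤ ⊤)) u v

theorem fderiv_fderiv_fderiv_symm (h : IsIsometricAt G G' F p) (u v : V) :
    fderiv ℝ (fderiv ℝ (fderiv ℝ F)) p u v = fderiv ℝ (fderiv ℝ (fderiv ℝ F)) p v u :=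
  h.contDiffAt_fderiv.isSymmSndFDerivAt (by
    rw [minSmoothness_of_isRCLikeNormedField]
    exact WithTop.coe_le_coe.2 (le_top : (2 : ℕ∞) ≤ ⊤)) u v

theorem apply_eq (h : IsIsometricAt G G' F p) (u v : V) :
    G p u v = G' (F p) (fderiv ℝ F p u) (fderiv ℝ F p v) :=
  h.isometric.self_of_nhds u v

/-- The isometry identity holds on a neighbourhood, so it may be differentiated by the product rule.
-/
theorem fderiv_metric (h : IsIsometricAt G G' F p) (u v w : V) :
    fderiv ℝ G p u v w =
      fderiv ℝ G' (F p) (fderiv ℝ F p u) (fderiv ℝ F p v) (fderiv ℝ F p w) +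
      G' (F p) (fderiv ℝ (fderiv ℝ F) p u v) (fderiv ℝ F p w) +
      G' (F p) (fderiv ℝ F p v) (fderiv ℝ (fderiv ℝ F) p u w) := by
  have h1 : HasFDerivAt (fun z ↦ G z v w) _ p :=
    ((h.source.differentiableAt.hasFDerivAt).clm_apply (hasFDerivAt_const v p)).clm_apply
      (hasFDerivAt_const w p)
  have h2 := ((h.target.differentiableAt.hasFDerivAt.comp p h.hasFDerivAt).clm_apply
    (h.hasFDerivAt_fderiv.clm_apply (hasFDerivAt_const v p))).clm_apply
    (h.hasFDerivAt_fderiv.clm_apply (hasFDerivAt_const w p))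
  have h3 := h1.unique (h2.congr_of_eventuallyEq (h.isometric.mono fun z hz ↦ hz v w))
  have h4 := congrArg (fun l : V →L[ℝ] ℝ ↦ l u) h3
  simp at h4
  rw [h4]
  ring

variable [FiniteDimensional ℝ V] [FiniteDimensional ℝ W]

theorem coordSecondForm_symm (h : IsIsometricAt G G' F p) (u v : V) :
    coordSecondForm G G' F p u v = coordSecondForm G G' F p v u := by
  simp only [coordSecondForm, pushforwardDeriv, christoffelBilin_apply, h.fderiv_fderiv_symm u v,
    h.source.christoffel_symm u v, h.target.christoffel_symm (fderiv ℝ F p u)]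

/-- The second fundamental form takes values in the normal space. -/
theorem coordSecondForm_normal (h : IsIsometricAt G G' F p) (u v w : V) :
    G' (F p) (coordSecondForm G G' F p u v) (fderiv ℝ F p w) = 0 := by
  simp only [coordSecondForm, pushforwardDeriv, christoffelBilin_apply, map_sub, map_add,
    sub_apply, add_apply]
  -- Both connections become Koszul expressions. Expanding the derivatives of `G` cancels those of
  -- `G'`, and symmetry of `D²F` cancels the rest.
  rw [← h.apply_eq, h.source.apply_christoffel, h.target.apply_christoffel, h.fderiv_metric,
    h.fderiv_metric, h.fderiv_metric, h.fderiv_fderiv_symm w u, h.fderiv_fderiv_symm w v,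
    h.fderiv_fderiv_symm v u, h.target.symm_self (fderiv ℝ F p v),
    h.target.symm_self (fderiv ℝ F p u)]
  ring

omit [FiniteDimensional ℝ V] in
/-- The derivative of `pushforwardDeriv` on constant fields. -/
theorem hasFDerivAt_pushforwardDeriv (h : IsIsometricAt G G' F p) (v w : V) :
    ∃ D : V →L[ℝ] W, HasFDerivAt (fun y ↦ pushforwardDeriv G' F y v w) D p ∧
      ∀ u, D u = fderiv ℝ (fderiv ℝ (fderiv ℝ F)) p u v w +
        fderiv ℝ (christoffelBilin G') (F p) (fderiv ℝ F p u) (fderiv ℝ F p v) (fderiv ℝ F p w) +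
        christoffelBilin G' (F p) (fderiv ℝ (fderiv ℝ F) p u v) (fderiv ℝ F p w) +
        christoffelBilin G' (F p) (fderiv ℝ F p v) (fderiv ℝ (fderiv ℝ F) p u w) := by
  have h1 := ((h.hasFDerivAt_fderiv_fderiv).clm_apply (hasFDerivAt_const v p)).clm_apply
    (hasFDerivAt_const w p)
  have hC := (h.target.contDiffAt_christoffelBilin.differentiableAt (by simp)).hasFDerivAt
  have h2 := ((hC.comp p h.hasFDerivAt).clm_apply
    (h.hasFDerivAt_fderiv.clm_apply (hasFDerivAt_const v p))).clm_apply
    (h.hasFDerivAt_fderiv.clm_apply (hasFDerivAt_const w p))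
  refine ⟨_, h1.add h2, fun u ↦ ?_⟩
  simp
  abel

/-- The derivative of the second fundamental form on constant fields. -/
theorem hasFDerivAt_coordSecondForm (h : IsIsometricAt G G' F p) (v w : V) :
    ∃ D : V →L[ℝ] W, HasFDerivAt (fun y ↦ coordSecondForm G G' F y v w) D p ∧
      ∀ u, D u = fderiv ℝ (fderiv ℝ (fderiv ℝ F)) p u v w +
        fderiv ℝ (christoffelBilin G') (F p) (fderiv ℝ F p u) (fderiv ℝ F p v) (fderiv ℝ F p w) +
        christoffelBilin G' (F p) (fderiv ℝ (fderiv ℝ F) p u v) (fderiv ℝ F p w) +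
        christoffelBilin G' (F p) (fderiv ℝ F p v) (fderiv ℝ (fderiv ℝ F) p u w) -
        fderiv ℝ (fderiv ℝ F) p u (christoffelBilin G p v w) -
        fderiv ℝ F p (fderiv ℝ (christoffelBilin G) p u v w) := by
  obtain ⟨D, hD, hDu⟩ := h.hasFDerivAt_pushforwardDeriv v w
  have hC := (h.source.contDiffAt_christoffelBilin.differentiableAt (by simp)).hasFDerivAt
  have h1 := h.hasFDerivAt_fderiv.clm_apply
    ((hC.clm_apply (hasFDerivAt_const v p)).clm_apply (hasFDerivAt_const w p))
  refine ⟨_, hD.sub h1, fun u ↦ ?_⟩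
  simp [hDu]
  abel

/-- The Weingarten equation: the tangential part of the covariant derivative of `h(v, w)`. -/
theorem weingarten (h : IsIsometricAt G G' F p) (v w : V) {D : V →L[ℝ] W}
    (hD : HasFDerivAt (fun y ↦ coordSecondForm G G' F y v w) D p) (u z : V) :
    G' (F p) (D u + christoffelBilin G' (F p) (fderiv ℝ F p u) (coordSecondForm G G' F p v w))
        (fderiv ℝ F p z) =
      -G' (F p) (coordSecondForm G G' F p v w) (coordSecondForm G G' F p u z) := by
  have h0 : (fun y ↦ G' (F y) (coordSecondForm G G' F y v w) (fderiv ℝ F y z)) =ᶠ[𝓝 p]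
      fun _ ↦ 0 := h.eventually.mono fun y hy ↦ hy.coordSecondForm_normal v w z
  -- Differentiate `⟨h(v,w), DF z⟩ = 0`. Metric compatibility produces the covariant derivatives,
  -- and `h4` drops the tangential part of that of `DF z`.
  have h1 := (((h.target.differentiableAt.hasFDerivAt.comp p h.hasFDerivAt).clm_apply
    hD).clm_apply (h.hasFDerivAt_fderiv.clm_apply (hasFDerivAt_const z p)))
  have h2 := h1.unique ((hasFDerivAt_const (0 : ℝ) p).congr_of_eventuallyEq h0)
  have h3 := congrArg (fun l : V →L[ℝ] ℝ ↦ l u) h2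
  simp [h.target.fderiv_apply] at h3
  have h4 := h.coordSecondForm_normal v w (christoffelBilin G p u z)
  have h5 : coordSecondForm G G' F p u z + fderiv ℝ F p (christoffelBilin G p u z) =
    pushforwardDeriv G' F p u z := by simp [coordSecondForm]
  have h6 := congrArg (G' (F p) (coordSecondForm G G' F p v w)) h5
  simp only [pushforwardDeriv, christoffelBilin_apply, map_add, add_apply] at h3 h4 h6 ⊢
  linarith

/-- The Gauss equation. -/
theorem gauss_equation (h : IsIsometricAt G G' F p) (u v w z : V) :
    G' (F p) (curvatureOperator G' (F p) (fderiv ℝ F p u) (fderiv ℝ F p v) (fderiv ℝ F p w))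
        (fderiv ℝ F p z) =
      G p (curvatureOperator G p u v w) z -
        G' (F p) (coordSecondForm G G' F p v w) (coordSecondForm G G' F p u z) +
        G' (F p) (coordSecondForm G G' F p u w) (coordSecondForm G G' F p v z) := by
  obtain ⟨D₁, hD₁, hDu⟩ := h.hasFDerivAt_coordSecondForm v w
  obtain ⟨D₂, hD₂, hDv⟩ := h.hasFDerivAt_coordSecondForm u w
  have w₁ := h.weingarten v w hD₁ u z
  have w₂ := h.weingarten u w hD₂ v z
  have n₁ := h.coordSecondForm_normal u (christoffelBilin G p v w) z
  have n₂ := h.coordSecondForm_normal v (christoffelBilin G p u w) z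
  rw [hDu] at w₁
  rw [hDv] at w₂
  rw [h.apply_eq]
  simp only [curvatureOperator, h.target.fderiv_christoffel, h.source.fderiv_christoffel]
  simp only [← christoffelBilin_apply]
  -- With the derivatives of `F` in matching order, subtracting `w₂` from `w₁` cancels the third
  -- derivatives. The terms `D²F(u, Γ(v,w))` and `D²F(v, Γ(u,w))` are resolved by normality in `n₁`,
  -- `n₂`.
  rw [h.fderiv_fderiv_symm v u, h.fderiv_fderiv_fderiv_symm v u] at w₂
  have e₁ : ∀ a b, coordSecondForm G G' F p a b = fderiv ℝ (fderiv ℝ F) p a b +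
      christoffelBilin G' (F p) (fderiv ℝ F p a) (fderiv ℝ F p b) -
      fderiv ℝ F p (christoffelBilin G p a b) := fun _ _ ↦ rfl
  have c₁ := congrArg (fun t ↦ G' (F p) (christoffelBilin G' (F p) (fderiv ℝ F p u) t)
    (fderiv ℝ F p z)) (e₁ v w)
  have c₂ := congrArg (fun t ↦ G' (F p) (christoffelBilin G' (F p) (fderiv ℝ F p v) t)
    (fderiv ℝ F p z)) (e₁ u w)
  rw [e₁] at n₁ n₂
  simp only [map_add, map_sub, add_apply, sub_apply] at w₁ w₂ n₁ n₂ c₁ c₂ ⊢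
  linarith

end IsIsometricAt
end GaussEquation
-- The metric of a manifold in its preferred charts.
section Charts

variable {n : ℕ} {M : Type*} [TopologicalSpace M] [ChartedSpace (Coord n) M]
  [IsManifold (𝓡 n) ∞ M]

/-- The differential of the inverse of the preferred chart at `x`. -/
noncomputable def chartFrame (n : ℕ) {M : Type*} [TopologicalSpace M] [ChartedSpace (Coord n) M]
    (x : M) (y : Coord n) : Coord n →L[ℝ] Coord n :=
  mfderiv 𝓘(ℝ, Coord n) (𝓡 n) (extChartAt (𝓡 n) x).symm y

/-- The metric at `b`, as a bilinear form on the coordinate space. -/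
noncomputable def innerAt (g : SmoothMetric n M) (b : M) : Coord n →L[ℝ] Coord n →L[ℝ] ℝ :=
  g.inner b

theorem metricInChart_apply (g : SmoothMetric n M) (x : M) (y u v : Coord n) :
    metricInChart g x y u v =
      innerAt g ((extChartAt (𝓡 n) x).symm y) (chartFrame n x y u) (chartFrame n x y v) := rfl

/-- The tangent map of the inverse chart carries constant fields to smooth fields along it, and a
smooth bundle metric evaluates smooth fields smoothly. -/
theorem contDiffOn_metricInChart_apply (g : SmoothMetric n M) (x : M) (u v : Coord n) :
    ContDiffOn ℝ ∞ (fun y ↦ metricInChart g x y u v) (extChartAt (𝓡 n) x).target := by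
  have hs := contMDiffOn_extChartAt_symm (I := 𝓡 n) (n := ∞) x
  have ho := isOpen_extChartAt_target (I := 𝓡 n) x
  have ht := hs.contMDiffOn_tangentMapWithin (m := ∞) (by simp) ho.uniqueMDiffOn
  have hsec (w : Coord n) : ContMDiffOn 𝓘(ℝ, Coord n) (𝓡 n).tangent ∞
      (fun y ↦ (⟨(extChartAt (𝓡 n) x).symm y, chartFrame n x y w⟩ : TangentBundle (𝓡 n) M))
      (extChartAt (𝓡 n) x).target := by
    have hc : ContMDiffOn 𝓘(ℝ, Coord n) 𝓘(ℝ, Coord n).tangent ∞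
        (fun y ↦ (⟨y, w⟩ : TangentBundle 𝓘(ℝ, Coord n) (Coord n)))
        (extChartAt (𝓡 n) x).target := fun y hy ↦
      contMDiffWithinAt_vectorSpace_iff_contDiffWithinAt.2 contDiffWithinAt_const
    refine (ht.comp hc fun y hy ↦ hy).congr fun y hy ↦ ?_
    have h := mfderivWithin_of_isOpen (I := 𝓘(ℝ, Coord n)) (I' := 𝓡 n)
      (f := (extChartAt (𝓡 n) x).symm) ho hy
    exact congrArg (fun L : Coord n →L[ℝ] Coord n ↦
      (⟨(extChartAt (𝓡 n) x).symm y, L w⟩ : TangentBundle (𝓡 n) M)) h.symm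
  have hg := g.contMDiff.comp_contMDiffOn hs
  have := ContMDiffOn.clm_bundle_apply₂ (F₁ := Coord n) (F₂ := Coord n) (F₃ := ℝ)
    (E₃ := Bundle.Trivial M ℝ) hg (hsec u) (hsec v)
  intro y hy
  have h := this y hy
  simp only [Bundle.contMDiffWithinAt_totalSpace] at h
  exact h.2.contDiffWithinAt

theorem mdifferentiableAt_extChartAt_symm {x : M} {y : Coord n}
    (hy : y ∈ (extChartAt (𝓡 n) x).target) :
    MDifferentiableAt 𝓘(ℝ, Coord n) (𝓡 n) (extChartAt (𝓡 n) x).symm y := by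
  have h := mdifferentiableWithinAt_extChartAt_symm (I := 𝓡 n) hy
  rwa [ModelWithCorners.range_eq_univ, mdifferentiableWithinAt_univ] at h

theorem fderivWithin_range {m : ℕ} (F : Coord n → Coord m) (y : Coord n) :
    fderivWithin ℝ F (Set.range (𝓡 n)) y = fderiv ℝ F y := by
  rw [ModelWithCorners.range_eq_univ, fderivWithin_univ]

/-- Read in the chart at `x`, the inverse chart is the identity near the base point. Tangent vectors
at `x` are therefore their own coordinate vectors. -/
theorem chartFrame_self (x : M) :
    chartFrame n x (extChartAt (𝓡 n) x x) = ContinuousLinearMap.id ℝ _ := by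
  have h1 := (mdifferentiableAt_extChartAt_symm (mem_extChartAt_target (I := 𝓡 n) x)).mfderiv
  refine h1.trans ((fderivWithin_range _ _).trans ?_)
  have h2 : writtenInExtChartAt 𝓘(ℝ, Coord n) (𝓡 n) (extChartAt (𝓡 n) x x)
      (extChartAt (𝓡 n) x).symm =ᶠ[𝓝 (extChartAt (𝓡 n) x x)] id := by
    filter_upwards [(isOpen_extChartAt_target (I := 𝓡 n) x).mem_nhds (mem_extChartAt_target x)]
      with y hy
    have h3 : writtenInExtChartAt 𝓘(ℝ, Coord n) (𝓡 n) (extChartAt (𝓡 n) x x)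
      (extChartAt (𝓡 n) x).symm y = extChartAt (𝓡 n) ((extChartAt (𝓡 n) x).symm
        (extChartAt (𝓡 n) x x)) ((extChartAt (𝓡 n) x).symm y) := rfl
    rw [h3, extChartAt_to_inv, (extChartAt (𝓡 n) x).right_inv hy, id]
  exact h2.fderiv_eq.trans fderiv_id

theorem metricInChart_self (g : SmoothMetric n M) (x : M) :
    metricInChart g x (extChartAt (𝓡 n) x x) = innerAt g x := by
  ext u v
  rw [metricInChart_apply, chartFrame_self, extChartAt_to_inv]
  rfl

omit [IsManifold (𝓡 n) ∞ M] in
theorem mfderivWithin_range_symm (x : M) (y : Coord n) :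
    mfderivWithin 𝓘(ℝ, Coord n) (𝓡 n) (extChartAt (𝓡 n) x).symm (Set.range (𝓡 n)) y =
      chartFrame n x y := by
  rw [ModelWithCorners.range_eq_univ, mfderivWithin_univ]
  rfl

theorem chartFrame_injective {x : M} {y : Coord n} (hy : y ∈ (extChartAt (𝓡 n) x).target) :
    Function.Injective (chartFrame n x y) := by
  have := IsManifold.of_le (I := 𝓡 n) (M := M) (show (1 : WithTop ℕ∞) ≤ ∞ by simp)
  have h := isInvertible_mfderivWithin_extChartAt_symm (I := 𝓡 n) hy
  rw [mfderivWithin_range_symm] at h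
  exact h.injective

/-- The metric at each point is positive definite. -/
theorem innerAt_pos (g : SmoothMetric n M) (b : M) (v : Coord n) (hv : v ≠ 0) :
    0 < innerAt g b v v := g.pos b v hv

theorem innerAt_symm (g : SmoothMetric n M) (b : M) (u v : Coord n) :
    innerAt g b u v = innerAt g b v u := g.symm b u v

theorem isMetricAt_metricInChart (g : SmoothMetric n M) (x : M) :
    IsMetricAt (metricInChart g x) (extChartAt (𝓡 n) x x) := by
  have ho := isOpen_extChartAt_target (I := 𝓡 n) x
  have hsm : ContDiffOn ℝ ∞ (metricInChart g x) (extChartAt (𝓡 n) x).target :=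
    contDiffOn_clm_apply.2 fun u ↦ contDiffOn_clm_apply.2 fun v ↦
      contDiffOn_metricInChart_apply g x u v
  refine ⟨?_, ?_, ?_⟩
  · filter_upwards [ho.mem_nhds (mem_extChartAt_target x)] with y hy using
      hsm.contDiffAt (ho.mem_nhds hy)
  · exact Filter.Eventually.of_forall fun y u v ↦ innerAt_symm g _ _ _
  · filter_upwards [ho.mem_nhds (mem_extChartAt_target x)] with y hy v hv
    exact innerAt_pos g _ _ fun h ↦ hv (chartFrame_injective hy (h.trans (map_zero _).symm))

end Charts

/-! ### The immersion and its second fundamental form in charts. -/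

section Immersion

variable {n m : ℕ} {M N : Type*}
  [TopologicalSpace M] [ChartedSpace (Coord n) M] [IsManifold (𝓡 n) ∞ M]
  [TopologicalSpace N] [ChartedSpace (Coord m) N] [IsManifold (𝓡 m) ∞ N]
  {g : SmoothMetric n M} {g' : SmoothMetric m N} {f : M → N}

omit [IsManifold (𝓡 n) ∞ M] [IsManifold (𝓡 m) ∞ N] in
theorem writtenInExtChartAt_self (f : M → N) (x : M) :
    writtenInExtChartAt (𝓡 n) (𝓡 m) x f (extChartAt (𝓡 n) x x) =
      extChartAt (𝓡 m) (f x) (f x) := by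
  simp only [writtenInExtChartAt, Function.comp_apply, extChartAt_to_inv]

theorem IsIsometricImmersion.contDiffAt_written (hf : IsIsometricImmersion g g' f) {x : M}
    {y : Coord n} (hy : y ∈ (extChartAt (𝓡 n) x).target)
    (hy' : f ((extChartAt (𝓡 n) x).symm y) ∈ (extChartAt (𝓡 m) (f x)).source) :
    ContDiffAt ℝ ∞ (writtenInExtChartAt (𝓡 n) (𝓡 m) x f) y := by
  have h1 := (contMDiffOn_extChartAt_symm (I := 𝓡 n) (n := ∞) x).contMDiffAt
    ((isOpen_extChartAt_target (I := 𝓡 n) x).mem_nhds hy)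
  have h2 := (contMDiffOn_extChartAt (I := 𝓡 m) (n := ∞) (x := f x)).contMDiffAt
    (((chartAt (Coord m) (f x)).open_source).mem_nhds (by simpa using hy'))
  exact (h2.comp y (hf.contMDiff.contMDiffAt.comp y h1)).contDiffAt

/-- The differential of `f` and its coordinate expression correspond under the chart frames. -/
theorem IsIsometricImmersion.chartFrame_fderiv (hf : IsIsometricImmersion g g' f) {x : M}
    {y : Coord n} (hy : y ∈ (extChartAt (𝓡 n) x).target)
    (hy' : f ((extChartAt (𝓡 n) x).symm y) ∈ (extChartAt (𝓡 m) (f x)).source) (u : Coord n) :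
    chartFrame m (f x) (writtenInExtChartAt (𝓡 n) (𝓡 m) x f y)
        (fderiv ℝ (writtenInExtChartAt (𝓡 n) (𝓡 m) x f) y u) =
      mfderiv (𝓡 n) (𝓡 m) f ((extChartAt (𝓡 n) x).symm y) (chartFrame n x y u) := by
  have hF' := ((hf.contDiffAt_written hy hy').differentiableAt (by simp)).hasFDerivAt
  generalize fderiv ℝ (writtenInExtChartAt (𝓡 n) (𝓡 m) x f) y = L at hF' ⊢
  have hF : HasMFDerivAt 𝓘(ℝ, Coord n) 𝓘(ℝ, Coord m) (writtenInExtChartAt (𝓡 n) (𝓡 m) x f) y L :=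
    hF'.hasMFDerivAt
  have hFy : writtenInExtChartAt (𝓡 n) (𝓡 m) x f y ∈ (extChartAt (𝓡 m) (f x)).target :=
    (extChartAt (𝓡 m) (f x)).map_source hy'
  have h1 := (mdifferentiableAt_extChartAt_symm hFy).hasMFDerivAt.comp y hF
  have h2 := (hf.contMDiff.mdifferentiableAt (by simp)).hasMFDerivAt.comp y
    (mdifferentiableAt_extChartAt_symm hy).hasMFDerivAt
  have hcont : ContinuousAt (f ∘ (extChartAt (𝓡 n) x).symm) y :=
    hf.contMDiff.continuous.continuousAt.comp (mdifferentiableAt_extChartAt_symm hy).continuousAt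
  have heq : f ∘ (extChartAt (𝓡 n) x).symm =ᶠ[𝓝 y]
      (extChartAt (𝓡 m) (f x)).symm ∘ writtenInExtChartAt (𝓡 n) (𝓡 m) x f := by
    filter_upwards [hcont ((isOpen_extChartAt_source (I := 𝓡 m) (f x)).mem_nhds hy')] with z hz
    exact ((extChartAt (𝓡 m) (f x)).left_inv hz).symm
  have h3 := hasMFDerivAt_unique (h1.congr_of_eventuallyEq heq) h2
  exact congrArg (fun L : Coord n →L[ℝ] Coord m ↦ L u) h3

theorem IsIsometricImmersion.isIsometricAt (hf : IsIsometricImmersion g g' f) (x : M) :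
    IsIsometricAt (metricInChart g x) (metricInChart g' (f x))
      (writtenInExtChartAt (𝓡 n) (𝓡 m) x f) (extChartAt (𝓡 n) x x) := by
  have hcont : ContinuousAt (f ∘ (extChartAt (𝓡 n) x).symm) (extChartAt (𝓡 n) x x) :=
    hf.contMDiff.continuous.continuousAt.comp (continuousAt_extChartAt_symm x)
  have hnear : ∀ᶠ y in 𝓝 (extChartAt (𝓡 n) x x), y ∈ (extChartAt (𝓡 n) x).target ∧
      f ((extChartAt (𝓡 n) x).symm y) ∈ (extChartAt (𝓡 m) (f x)).source := by
    have hs : (extChartAt (𝓡 m) (f x)).source ∈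
        𝓝 ((f ∘ (extChartAt (𝓡 n) x).symm) (extChartAt (𝓡 n) x x)) := by
      rw [Function.comp_apply, extChartAt_to_inv]
      exact extChartAt_source_mem_nhds (f x)
    filter_upwards [(isOpen_extChartAt_target (I := 𝓡 n) x).mem_nhds (mem_extChartAt_target x),
      hcont hs] with y h1 h2 using ⟨h1, h2⟩
  refine ⟨isMetricAt_metricInChart g x, ?_, ?_, ?_⟩
  · rw [writtenInExtChartAt_self]
    exact isMetricAt_metricInChart g' (f x)
  · filter_upwards [hnear] with y hy
    exact hf.contDiffAt_written hy.1 hy.2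
  · filter_upwards [hnear] with y hy u v
    rw [metricInChart_apply, metricInChart_apply, hf.chartFrame_fderiv hy.1 hy.2,
      hf.chartFrame_fderiv hy.1 hy.2]
    have h1 : (extChartAt (𝓡 m) (f x)).symm (writtenInExtChartAt (𝓡 n) (𝓡 m) x f y) =
        f ((extChartAt (𝓡 n) x).symm y) := (extChartAt (𝓡 m) (f x)).left_inv hy.2
    rw [h1]
    exact (hf.isometric _ _ _).symm

theorem IsIsometricImmersion.secondFundamentalForm_eq (hf : IsIsometricImmersion g g' f) (x : M)
    (u v : Coord n) :
    secondFundamentalForm g g' f x u v =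
      coordSecondForm (metricInChart g x) (metricInChart g' (f x))
        (writtenInExtChartAt (𝓡 n) (𝓡 m) x f) (extChartAt (𝓡 n) x x) u v := by
  have h := (hf.isIsometricAt x).hasFDerivAt_fderiv.clm_apply (hasFDerivAt_const v _)
  have h2 : fderiv ℝ (fun y ↦ fderiv ℝ (writtenInExtChartAt (𝓡 n) (𝓡 m) x f) y v)
      (extChartAt (𝓡 n) x x) u = fderiv ℝ (fderiv ℝ (writtenInExtChartAt (𝓡 n) (𝓡 m) x f))
        (extChartAt (𝓡 n) x x) u v := by
    rw [h.fderiv]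
    simp
  rw [coordSecondForm, pushforwardDeriv, christoffelBilin_apply, christoffelBilin_apply,
    writtenInExtChartAt_self, ← h2]
  rfl

end Immersion

/-! ### Bessel's inequality and traces of a vector-valued bilinear map. -/

section BilinearAlgebra

variable {V W : Type*} [AddCommGroup V] [Module ℝ V] [AddCommGroup W] [Module ℝ W]

/-- The Gram-Schmidt vector `B X X • Y - B X Y • X` is nonzero, and its square is `B X X` times the
Gram determinant. -/
theorem gram_pos {B : V →ₗ[ℝ] V →ₗ[ℝ] ℝ} (hs : ∀ u v, B u v = B v u)
    (hp : ∀ v, v ≠ 0 → 0 < B v v) {X Y : V} (h : LinearIndependent ℝ ![X, Y]) :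
    0 < B X X * B Y Y - B X Y ^ 2 := by
  have hX : X ≠ 0 := h.ne_zero 0
  have hZ : B X X • Y - B X Y • X ≠ 0 := by
    intro h0
    have h1 := LinearIndependent.pair_iff.1 h (-B X Y) (B X X) (by rw [← h0, neg_smul]; abel)
    exact (hp X hX).ne' h1.2
  have h2 := hp _ hZ
  simp only [map_sub, map_smul, LinearMap.sub_apply, LinearMap.smul_apply, smul_eq_mul,
    hs Y X] at h2
  have h3 := hp X hX
  refine pos_of_mul_pos_right (a := B X X) ?_ h3.le
  linarith

/-- Bessel's inequality for two vectors and a positive semidefinite form. -/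
theorem bessel_pair {ι : Type*} [Fintype ι] {B : W →ₗ[ℝ] W →ₗ[ℝ] ℝ} (hs : ∀ u v, B u v = B v u)
    (hp : ∀ v, 0 ≤ B v v) (z : ι → W) (a b : ι → ℝ) (haa : ∑ i, a i * a i = 1)
    (hbb : ∑ i, b i * b i = 1) (hab : ∑ i, a i * b i = 0) :
    B (∑ i, a i • z i) (∑ i, a i • z i) + B (∑ i, b i • z i) (∑ i, b i • z i) ≤
      ∑ i, B (z i) (z i) := by
  set P := ∑ i, a i • z i with hP
  set R := ∑ i, b i • z i with hR
  -- `P` and `R` are the components of the tuple `z` along `a` and `b`; the residual after removing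
  -- both has nonnegative total square.
  have h1 : 0 ≤ ∑ i, B (z i - a i • P - b i • R) (z i - a i • P - b i • R) :=
    Finset.sum_nonneg fun i _ ↦ hp _
  have h2 : ∀ i, B (z i - a i • P - b i • R) (z i - a i • P - b i • R) =
      B (z i) (z i) - 2 * (a i * B (z i) P) - 2 * (b i * B (z i) R) + a i * a i * B P P +
        b i * b i * B R R + 2 * (a i * b i * B P R) := by
    intro i
    simp only [map_sub, map_smul, LinearMap.sub_apply, LinearMap.smul_apply, smul_eq_mul,
      hs P (z i), hs R (z i), hs R P]
    ring
  have hPP (Q : W) : ∑ i, a i * B (z i) Q = B P Q := by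
    simp [hP]
  have hRR (Q : W) : ∑ i, b i * B (z i) Q = B R Q := by
    simp [hR]
  simp only [h2, Finset.sum_add_distrib, Finset.sum_sub_distrib, ← Finset.mul_sum,
    ← Finset.sum_mul, hPP, hRR, haa, hbb, hab] at h1
  linarith

/-- An orthonormal family of full cardinality spans, and coordinates compute the form. -/
theorem exists_coord_of_orthonormal {n : ℕ} [FiniteDimensional ℝ V]
    (hn : Module.finrank ℝ V = n) (B : V →ₗ[ℝ] V →ₗ[ℝ] ℝ) {e : Fin n → V}
    (he : ∀ i j, B (e i) (e j) = if i = j then 1 else 0) (X : V) :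
    X = ∑ i, B X (e i) • e i := by
  have hli : LinearIndependent ℝ e := by
    rw [Fintype.linearIndependent_iff]
    intro c hc i
    have h := congrArg (fun v ↦ B v (e i)) hc
    simpa [he] using h
  have hspan : X ∈ Submodule.span ℝ (Set.range e) := by
    rw [hli.span_eq_top_of_card_eq_finrank' (by simp [hn])]
    trivial
  obtain ⟨c, rfl⟩ := (Submodule.mem_span_range_iff_exists_fun ℝ).1 hspan
  simp [he]

variable {n : ℕ} [FiniteDimensional ℝ V]
  {B : V →ₗ[ℝ] V →ₗ[ℝ] ℝ} {B' : W →ₗ[ℝ] W →ₗ[ℝ] ℝ} {e : Fin n → V} {h : V →ₗ[ℝ] V →ₗ[ℝ] W}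

theorem form_eq_sum_coord (hn : Module.finrank ℝ V = n)
    (he : ∀ i j, B (e i) (e j) = if i = j then 1 else 0) (X Y : V) :
    B X Y = ∑ i, B X (e i) * B Y (e i) := by
  have h1 : B X Y = B (∑ i, B X (e i) • e i) (∑ i, B Y (e i) • e i) := by
    rw [← exists_coord_of_orthonormal hn B he X, ← exists_coord_of_orthonormal hn B he Y]
  rw [h1]
  simp only [map_sum, LinearMap.sum_apply, map_smul, LinearMap.smul_apply, smul_eq_mul, he,
    mul_ite, mul_one, mul_zero]
  refine Finset.sum_congr rfl fun i _ ↦ ?_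
  simp [mul_comm]

/-- By Parseval, the coordinates of `X` and `Y` in the frame are orthonormal vectors of `ℝⁿ`, which
is the setting of `bessel_pair`. -/
theorem bessel_linearMap (hn : Module.finrank ℝ V = n)
    (he : ∀ i j, B (e i) (e j) = if i = j then 1 else 0)
    (hs' : ∀ u v, B' u v = B' v u) (hp' : ∀ v, 0 ≤ B' v v) (L : V →ₗ[ℝ] W) {X Y : V}
    (hX : B X X = 1) (hY : B Y Y = 1) (hXY : B X Y = 0) :
    B' (L X) (L X) + B' (L Y) (L Y) ≤ ∑ i, B' (L (e i)) (L (e i)) := by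
  have hL : ∀ Z, L Z = ∑ i, B Z (e i) • L (e i) := fun Z ↦ by
    conv_lhs => rw [exists_coord_of_orthonormal hn B he Z]
    simp
  rw [hL X, hL Y]
  refine bessel_pair hs' hp' _ _ _ ?_ ?_ ?_
  · rw [← form_eq_sum_coord hn he, hX]
  · rw [← form_eq_sum_coord hn he, hY]
  · rw [← form_eq_sum_coord hn he, hXY]

/-- The squared norm of a symmetric bilinear map dominates its restriction to a plane. -/
theorem restrict_norm_sq_le (hn : Module.finrank ℝ V = n)
    (he : ∀ i j, B (e i) (e j) = if i = j then 1 else 0)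
    (hs' : ∀ u v, B' u v = B' v u) (hp' : ∀ v, 0 ≤ B' v v) (hh : ∀ u v, h u v = h v u) {X Y : V}
    (hX : B X X = 1) (hY : B Y Y = 1) (hXY : B X Y = 0) :
    B' (h X X) (h X X) + B' (h Y Y) (h Y Y) + 2 * B' (h X Y) (h X Y) ≤
      ∑ i, ∑ j, B' (h (e i) (e j)) (h (e i) (e j)) := by
  -- Bessel is used in the second slot for each `h (e i)`, then, after symmetry, for `h X` and `h
  -- Y`. The mixed term appears in both of the latter, whence the factor 2.
  have h1 : ∀ Z, _ := fun Z ↦ bessel_linearMap hn he hs' hp' (h Z) hX hY hXY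
  have h2 := Finset.sum_le_sum fun i (_ : i ∈ Finset.univ) ↦ h1 (e i)
  rw [Finset.sum_add_distrib] at h2
  have h3 := h1 X
  have h4 := h1 Y
  simp only [hh (e _) X, hh (e _) Y] at h2
  rw [hh Y X] at h4
  linarith

/-- The quotient depends only on the plane, so Gram-Schmidt reduces to an orthonormal pair, where
`restrict_norm_sq_le` applies. -/
theorem abs_gauss_le (hn : Module.finrank ℝ V = n) (hs : ∀ u v, B u v = B v u)
    (hp : ∀ v, v ≠ 0 → 0 < B v v)
    (he : ∀ i j, B (e i) (e j) = if i = j then 1 else 0)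
    (hs' : ∀ u v, B' u v = B' v u) (hp' : ∀ v, 0 ≤ B' v v) (hh : ∀ u v, h u v = h v u) {X Y : V}
    (hXY : LinearIndependent ℝ ![X, Y]) :
    |(B' (h X X) (h Y Y) - B' (h X Y) (h X Y)) / (B X X * B Y Y - B X Y ^ 2)| ≤
      (∑ i, ∑ j, B' (h (e i) (e j)) (h (e i) (e j))) / 2 := by
  have hD := gram_pos hs hp hXY
  have hX := hp X (hXY.ne_zero 0)
  set a := √(B X X) with ha
  have ha0 : 0 < a := Real.sqrt_pos.2 hX
  have haa : a * a = B X X := Real.mul_self_sqrt hX.le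
  set D := B X X * B Y Y - B X Y ^ 2 with hDdef
  set b := √D with hb
  have hb0 : 0 < b := Real.sqrt_pos.2 hD
  have hbb : b * b = D := Real.mul_self_sqrt hD.le
  set X' := a⁻¹ • X with hX'
  set Y' := (a * b)⁻¹ • (B X X • Y - B X Y • X) with hY'
  have h1 : B X' X' = 1 := by
    simp only [hX', map_smul, LinearMap.smul_apply, smul_eq_mul, ← haa]
    field_simp
  have h2 : B X' Y' = 0 := by
    simp only [hX', hY', map_smul, map_sub, LinearMap.smul_apply, smul_eq_mul]
    ring
  have h3 : B Y' Y' = 1 := by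
    have : B Y' Y' = (a * b)⁻¹ ^ 2 * (B X X * D) := by
      simp only [hY', map_smul, map_sub, LinearMap.smul_apply, LinearMap.sub_apply, smul_eq_mul,
        hs Y X, hDdef]
      ring
    rw [this, ← haa, ← hbb]
    field_simp
  have hXe : X = a • X' := by
    rw [hX', smul_smul, mul_inv_cancel₀ ha0.ne', one_smul]
  have hYe : Y = (B X Y / a) • X' + (b / a) • Y' := by
    rw [hX', hY', smul_smul, smul_smul, smul_sub, smul_smul, smul_smul]
    have e1 : b / a * (a * b)⁻¹ * B X X = 1 := by rw [← haa]; field_simp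
    have e2 : b / a * (a * b)⁻¹ * B X Y = B X Y / a * a⁻¹ := by field_simp
    rw [e1, e2, one_smul]
    abel
  have key := restrict_norm_sq_le hn he hs' hp' hh h1 h3 h2
  have hQ : (B' (h X X) (h Y Y) - B' (h X Y) (h X Y)) / D =
      B' (h X' X') (h Y' Y') - B' (h X' Y') (h X' Y') := by
    -- The change of basis is triangular with diagonal `a`, `b / a`, hence determinant `b`; the
    -- numerator scales by its square, which is the Gram determinant.
    have : B' (h X X) (h Y Y) - B' (h X Y) (h X Y) =
        b * b * (B' (h X' X') (h Y' Y') - B' (h X' Y') (h X' Y')) := by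
      generalize B X Y / a = t at hYe
      have hab : b = a * (b / a) := by field_simp
      generalize b / a = r at hYe hab
      rw [hXe, hYe, hab]
      simp only [map_smul, map_add, LinearMap.smul_apply, LinearMap.add_apply, smul_eq_mul,
        hh Y' X', hs' (h X' Y') (h X' X')]
      ring
    rw [this, hbb]
    field_simp
  rw [hQ, abs_le]
  -- The squares of sum and difference give `|⟨p,q⟩| ≤ (|p|² + |q|²)/2`; `p3` accounts for the sign
  -- of the mixed term.
  have p1 := hp' (h X' X' + h Y' Y')
  have p2 := hp' (h X' X' - h Y' Y')
  have p3 := hp' (h X' Y')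
  simp only [map_add, map_sub, LinearMap.add_apply, LinearMap.sub_apply,
    hs' (h Y' Y') (h X' X')] at p1 p2
  constructor <;> linarith

theorem sum_Ioi_eq_half {q : Fin n → Fin n → ℝ} (hq : ∀ i j, q i j = q j i) (h0 : ∀ i, q i i = 0) :
    ∑ i, ∑ j ∈ Finset.Ioi i, q i j = (∑ i, ∑ j, q i j) / 2 := by
  have h1 : ∀ i, ∑ j, q i j = ∑ j ∈ Finset.Ioi i, q i j + ∑ j ∈ Finset.Iio i, q i j := by
    intro i
    have hu : (Finset.univ : Finset (Fin n)) = insert i (Finset.Ioi i ∪ Finset.Iio i) := by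
      ext j
      simp only [Finset.mem_univ, Finset.mem_insert, Finset.mem_union, Finset.mem_Ioi,
        Finset.mem_Iio, true_iff]
      exact (lt_trichotomy i j).elim (fun h ↦ Or.inr (Or.inl h))
        (fun h ↦ h.elim (fun h ↦ Or.inl h.symm) fun h ↦ Or.inr (Or.inr h))
    rw [hu, Finset.sum_insert (by simp), h0, zero_add, Finset.sum_union]
    rw [Finset.disjoint_left]
    intro j hj hj'
    exact lt_asymm (Finset.mem_Ioi.1 hj) (Finset.mem_Iio.1 hj')
  have h2 : ∑ i, ∑ j ∈ Finset.Iio i, q i j = ∑ i, ∑ j ∈ Finset.Ioi i, q i j := by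
    rw [Finset.sum_comm' (s' := fun j ↦ Finset.Ioi j) (t' := Finset.univ) (by simp)]
    exact Finset.sum_congr rfl fun i _ ↦ Finset.sum_congr rfl fun j _ ↦ hq j i
  simp only [h1, Finset.sum_add_distrib, h2]
  ring

-- The double sum of `⟨h(e_i,e_i), h(e_j,e_j)⟩` is the square of the trace of `h`, which vanishes;
-- only the squared norm survives.
omit [FiniteDimensional ℝ V] in
theorem sum_gauss_eq (hs' : ∀ u v, B' u v = B' v u) (hh : ∀ u v, h u v = h v u)
    (htr : ∑ i, h (e i) (e i) = 0) (c : ℝ) :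
    ∑ i, ∑ j ∈ Finset.Ioi i,
        (c + (B' (h (e i) (e i)) (h (e j) (e j)) - B' (h (e i) (e j)) (h (e i) (e j)))) =
      n * (n - 1) / 2 * c - (∑ i, ∑ j, B' (h (e i) (e j)) (h (e i) (e j))) / 2 := by
  simp only [Finset.sum_add_distrib (f := fun _ ↦ c)]
  rw [Finset.sum_add_distrib, sum_Ioi_eq_half (q := fun i j ↦
      B' (h (e i) (e i)) (h (e j) (e j)) - B' (h (e i) (e j)) (h (e i) (e j)))
    (fun i j ↦ by rw [hs' (h (e i) (e i)), hh (e i) (e j)]) fun i ↦ sub_self _]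
  have h1 : ∑ i, ∑ j, B' (h (e i) (e i)) (h (e j) (e j)) = 0 := by
    simp only [← map_sum, htr, map_zero, Finset.sum_const_zero]
  have h2 : ∑ i : Fin n, ∑ _j ∈ Finset.Ioi i, c = n * (n - 1) / 2 * c := by
    -- The diagonal is set to zero so that halving the full double sum counts the `n(n-1)/2` pairs.
    have h3 := sum_Ioi_eq_half (n := n) (q := fun i j ↦ if i = j then 0 else c)
      (fun i j ↦ by simp [eq_comm]) (by simp)
    have h4 : ∀ i j : Fin n, (if i = j then (0 : ℝ) else c) = c - if i = j then c else 0 := by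
      intro i j
      split_ifs <;> simp
    have h5 : ∑ i : Fin n, ∑ _j ∈ Finset.Ioi i, c =
        ∑ i : Fin n, ∑ j ∈ Finset.Ioi i, if i = j then 0 else c :=
      Finset.sum_congr rfl fun i _ ↦ Finset.sum_congr rfl fun j hj ↦
        (if_neg (Finset.mem_Ioi.1 hj).ne).symm
    rw [h5, h3]
    simp [h4]
    ring
  simp only [Finset.sum_sub_distrib, h1, h2]
  ring

end BilinearAlgebra

/-! ### The curvatures of a minimal submanifold of a space form. -/

section CurvatureBounds

variable {n m : ℕ} {M N : Type*}
  [TopologicalSpace M] [ChartedSpace (Coord n) M] [IsManifold (𝓡 n) ∞ M]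
  [TopologicalSpace N] [ChartedSpace (Coord m) N] [IsManifold (𝓡 m) ∞ N]
  {g : SmoothMetric n M} {g' : SmoothMetric m N} {f : M → N}

/-- The metric at a point as a bilinear form. -/
noncomputable def innerForm (g : SmoothMetric n M) (b : M) : Coord n →ₗ[ℝ] Coord n →ₗ[ℝ] ℝ :=
  LinearMap.mk₂ ℝ (fun u v ↦ innerAt g b u v) (by simp) (by simp) (by simp) (by simp)

/-- The second fundamental form at a point as a bilinear map. -/
noncomputable def secondForm (g : SmoothMetric n M) (g' : SmoothMetric m N) (f : M → N) (x : M) :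
    Coord n →ₗ[ℝ] Coord n →ₗ[ℝ] Coord m :=
  LinearMap.mk₂ ℝ (fun u v ↦ coordSecondForm (metricInChart g x) (metricInChart g' (f x))
      (writtenInExtChartAt (𝓡 n) (𝓡 m) x f) (extChartAt (𝓡 n) x x) u v)
    (fun _ _ _ ↦ by simp [coordSecondForm, pushforwardDeriv]; abel)
    (fun _ _ _ ↦ by simp [coordSecondForm, pushforwardDeriv, smul_add, smul_sub])
    (fun _ _ _ ↦ by simp [coordSecondForm, pushforwardDeriv]; abel)
    (fun _ _ _ ↦ by simp [coordSecondForm, pushforwardDeriv, smul_add, smul_sub])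

theorem innerForm_pos (g : SmoothMetric n M) (b : M) (v : Coord n) (hv : v ≠ 0) :
    0 < innerForm g b v v := innerAt_pos g b v hv

theorem innerForm_nonneg (g : SmoothMetric n M) (b : M) (v : Coord n) :
    0 ≤ innerForm g b v v := by
  rcases eq_or_ne v 0 with rfl | hv
  · simp
  · exact (innerForm_pos g b v hv).le

theorem innerForm_symm (g : SmoothMetric n M) (b : M) (u v : Coord n) :
    innerForm g b u v = innerForm g b v u := innerAt_symm g b u v

theorem riemannTensor_of_isRealSpaceForm {c : ℝ} (hN : IsRealSpaceForm g' c) (q : N)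
    {X Y : Coord m} (hXY : LinearIndependent ℝ ![X, Y]) :
    riemannTensor g' q X Y X Y =
      c * (innerForm g' q X X * innerForm g' q Y Y - innerForm g' q X Y ^ 2) := by
  have hD := gram_pos (innerForm_symm g' q) (innerForm_pos g' q) hXY
  exact (div_eq_iff hD.ne').1 (hN q X Y hXY)

theorem IsIsometricImmersion.gauss (hf : IsIsometricImmersion g g' f) {c : ℝ}
    (hN : IsRealSpaceForm g' c) (x : M) {X Y : Coord n} (hXY : LinearIndependent ℝ ![X, Y]) :
    riemannTensor g x X Y X Y =
      c * (innerForm g x X X * innerForm g x Y Y - innerForm g x X Y ^ 2) +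
      (innerForm g' (f x) (secondForm g g' f x X X) (secondForm g g' f x Y Y) -
        innerForm g' (f x) (secondForm g g' f x X Y) (secondForm g g' f x X Y)) := by
  have h := hf.isIsometricAt x
  have hG := h.gauss_equation X Y Y X
  have hiso := h.apply_eq
  have hsymm := h.coordSecondForm_symm Y X
  rw [writtenInExtChartAt_self] at hG
  simp only [writtenInExtChartAt_self, metricInChart_self] at hG hiso
  set L := fderiv ℝ (writtenInExtChartAt (𝓡 n) (𝓡 m) x f) (extChartAt (𝓡 n) x x) with hL
  -- The space form condition concerns independent pairs only; `L` is injective because it preserves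
  -- a positive definite form.
  have hLi : LinearIndependent ℝ ![L X, L Y] := by
    have hinj : Function.Injective L := by
      refine (injective_iff_map_eq_zero L).2 fun v hv ↦ ?_
      by_contra hne
      have h1 := innerAt_pos g x v hne
      rw [hiso, hv] at h1
      simp at h1
    have h2 := hXY.map' (L : Coord n →ₗ[ℝ] Coord m) (LinearMap.ker_eq_bot.2 hinj)
    have h3 : ![L X, L Y] = (L : Coord n →ₗ[ℝ] Coord m) ∘ ![X, Y] := by
      ext i
      fin_cases i <;> rfl
    rw [h3]
    exact h2
  have hR := riemannTensor_of_isRealSpaceForm hN (f x) hLi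
  have h1 : riemannTensor g' (f x) (L X) (L Y) (L X) (L Y) =
    innerAt g' (f x) (curvatureOperator (metricInChart g' (f x))
      (extChartAt (𝓡 m) (f x) (f x)) (L X) (L Y) (L Y)) (L X) := rfl
  have h2 : riemannTensor g x X Y X Y = innerAt g x (curvatureOperator (metricInChart g x)
    (extChartAt (𝓡 n) x x) X Y Y) X := rfl
  have h3 : ∀ u v, innerForm g x u v = innerForm g' (f x) (L u) (L v) := hiso
  rw [h2, h3, h3, h3]
  rw [h1, hG, hsymm] at hR
  have h4 : ∀ u v u' v', innerForm g' (f x) (secondForm g g' f x u v) (secondForm g g' f x u' v') =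
    innerAt g' (f x)
      (coordSecondForm (metricInChart g x) (metricInChart g' (f x))
        (writtenInExtChartAt (𝓡 n) (𝓡 m) x f) (extChartAt (𝓡 n) x x) u v)
      (coordSecondForm (metricInChart g x) (metricInChart g' (f x))
        (writtenInExtChartAt (𝓡 n) (𝓡 m) x f) (extChartAt (𝓡 n) x x) u' v') := fun _ _ _ _ ↦ rfl
  rw [innerForm_symm g' (f x) (secondForm g g' f x X X), h4, h4]
  linarith

theorem IsIsometricImmersion.secondForm_symm (hf : IsIsometricImmersion g g' f) (x : M)
    (u v : Coord n) : secondForm g g' f x u v = secondForm g g' f x v u :=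
  (hf.isIsometricAt x).coordSecondForm_symm u v

theorem IsIsometricImmersion.sectionalCurvature_eq (hf : IsIsometricImmersion g g' f) {c : ℝ}
    (hN : IsRealSpaceForm g' c) (x : M) {X Y : Coord n} (hXY : LinearIndependent ℝ ![X, Y]) :
    sectionalCurvature g x X Y = c +
      (innerForm g' (f x) (secondForm g g' f x X X) (secondForm g g' f x Y Y) -
        innerForm g' (f x) (secondForm g g' f x X Y) (secondForm g g' f x X Y)) /
      (innerForm g x X X * innerForm g x Y Y - innerForm g x X Y ^ 2) := by
  have hD := gram_pos (innerForm_symm g x) (innerForm_pos g x) hXY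
  have h1 : sectionalCurvature g x X Y = riemannTensor g x X Y X Y /
    (innerForm g x X X * innerForm g x Y Y - innerForm g x X Y ^ 2) := rfl
  rw [h1, hf.gauss hN x hXY, add_div, mul_div_cancel_right₀ _ hD.ne']

theorem linearIndependent_pair_of_orthonormal {B : Coord n →ₗ[ℝ] Coord n →ₗ[ℝ] ℝ}
    {X Y : Coord n} (hX : B X X = 1) (hY : B Y Y = 1) (hXY : B X Y = 0) (hYX : B Y X = 0) :
    LinearIndependent ℝ ![X, Y] := by
  refine LinearIndependent.pair_iff.2 fun s t h ↦ ⟨?_, ?_⟩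
  · simpa [hX, hYX] using congrArg (fun v ↦ B v X) h
  · simpa [hY, hXY] using congrArg (fun v ↦ B v Y) h

theorem IsMinimalIsometricImmersion.trace_secondForm (hf : IsMinimalIsometricImmersion g g' f)
    (hn : n ≠ 0) (x : M) {e : Fin n → Coord n} (he : IsOrthonormalFrame g x e) :
    ∑ i, secondForm g g' f x (e i) (e i) = 0 := by
  have h := hf.meanCurvatureVector_eq_zero x e he
  have h1 : (1 / (n : ℝ)) • ∑ i, secondForm g g' f x (e i) (e i) = 0 := by
    refine Eq.trans ?_ h
    have h2 : ∀ i, secondForm g g' f x (e i) (e i) = secondFundamentalForm g g' f x (e i) (e i) :=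
      fun i ↦ (hf.toIsIsometricImmersion.secondFundamentalForm_eq x (e i) (e i)).symm
    exact congrArg ((1 / (n : ℝ)) • ·) (Finset.sum_congr rfl fun i _ ↦ h2 i)
  exact (smul_eq_zero.1 h1).resolve_left (by positivity)

theorem IsMinimalIsometricImmersion.scalarCurvature_eq (hf : IsMinimalIsometricImmersion g g' f)
    {c : ℝ} (hN : IsRealSpaceForm g' c) (hn : n ≠ 0) (x : M) {e : Fin n → Coord n}
    (he : IsOrthonormalFrame g x e) :
    scalarCurvature g x e = n * (n - 1) / 2 * c -
      (∑ i, ∑ j, innerForm g' (f x) (secondForm g g' f x (e i) (e j))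
        (secondForm g g' f x (e i) (e j))) / 2 := by
  rw [← sum_gauss_eq (innerForm_symm g' (f x)) (hf.toIsIsometricImmersion.secondForm_symm x)
    (hf.trace_secondForm hn x he) c]
  refine Finset.sum_congr rfl fun i _ ↦ Finset.sum_congr rfl fun j hj ↦ ?_
  have hij : i ≠ j := (Finset.mem_Ioi.1 hj).ne
  have he' : ∀ i j, innerForm g x (e i) (e j) = if i = j then 1 else 0 := he
  have h1 : innerForm g x (e i) (e i) = 1 := by rw [he', if_pos rfl]
  have h2 : innerForm g x (e j) (e j) = 1 := by rw [he', if_pos rfl]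
  have h3 : innerForm g x (e i) (e j) = 0 := by rw [he', if_neg hij]
  have h4 : innerForm g x (e j) (e i) = 0 := by rw [he', if_neg hij.symm]
  refine (hf.toIsIsometricImmersion.gauss hN x
    (linearIndependent_pair_of_orthonormal h1 h2 h3 h4)).trans ?_
  rw [h1, h2, h3]
  ring

end CurvatureBounds

end SpaceFormImmersion

open SpaceFormImmersion in
theorem corollary3p1 {n m : ℕ} (hn : 3 ≤ n)
    {M : Type*} [TopologicalSpace M] [ChartedSpace (Coord n) M] [IsManifold (𝓡 n) ∞ M]
    (g : SmoothMetric n M)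
    {N : Type*} [TopologicalSpace N] [ChartedSpace (Coord m) N] [IsManifold (𝓡 m) ∞ N]
    (g' : SmoothMetric m N) (c : ℝ) (hN : IsRealSpaceForm g' c)
    (hf : ∃ f : M → N, IsMinimalIsometricImmersion g g' f)
    (x : M) (e : Fin n → TangentSpace (𝓡 n) x) (he : IsOrthonormalFrame g x e)
    (X Y : TangentSpace (𝓡 n) x) (hXY : LinearIndependent ℝ ![X, Y]) :
    scalarCurvature g x e - ((n : ℝ) - 2) * ((n : ℝ) + 1) * c / 2 ≤ sectionalCurvature g x X Y ∧
      sectionalCurvature g x X Y ≤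
        -scalarCurvature g x e + ((n : ℝ) ^ 2 - (n : ℝ) + 2) * c / 2 := by
  obtain ⟨f, hf⟩ := hf
  have hτ := hf.scalarCurvature_eq hN (by omega) x he
  have hk := hf.toIsIsometricImmersion.sectionalCurvature_eq hN x hXY
  have hb := abs_gauss_le (B := innerForm g x) (B' := innerForm g' (f x)) (e := e)
    (h := secondForm g g' f x) (X := X) (Y := Y) (by simp) (innerForm_symm g x)
    (innerForm_pos g x) he (innerForm_symm g' (f x)) (innerForm_nonneg g' (f x))
    (hf.toIsIsometricImmersion.secondForm_symm x) hXY
  obtain ⟨h1, h2⟩ := abs_le.1 hb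
  -- After substitution `S` enters linearly, and `n(n-1)/2 ∓ 1` produces the coefficients
  -- `(n-2)(n+1)/2` and `(n²-n+2)/2`.
  rw [hτ, hk]
  constructor <;> linarith
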